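/- Let $\delta$ be a measurable cardinal and let $U$ be a normal ultrafilter on $\delta$ (a nonprincipal, $\delta$-complete ultrafilter on $\delta$ that is closed under diagonal intersections). Let $\mathrm{Ult}(V,U)$ be the transitive collapse of the ultrapower of the universe of sets $V$ by $U$. Let $\kappa$ be a singular cardinal of cofinality $\delta$ such that $2^\kappa=\kappa^+$ and $\lambda^\delta<\kappa$ for all cardinals $\lambda<\kappa$. If there exists a $\square_\kappa$-sequence, then there is a closed unbounded subset $C$ of $\kappa^+$ that is fresh over $\mathrm{Ult}(V,U)$. Here a set $A$ of ordinals is *fresh* over a class $M$ if $A\notin M$ and $A\cap\alpha\in M$ for every $\alpha<\mathrm{lub}(A)$, the least upper bound of $A$. A *$\square_\kappa$-sequence* is a sequence $\langle C_\gamma : \gamma<\kappa^+ \text{ a limit ordinal}\rangle$ such that (a) each $C_\gamma$ is a closed unbounded subset of $\gamma$; (b) if $\beta$ is a limit point of $C_\gamma$, then $C_\beta=C_\gamma\cap\beta$; (c) there is no closed unbounded subset $D$ of $\kappa^+$ with $D\cap\gamma=C_\gamma$ for all limit points $\gamma<\kappa^+$ of $D$; and (d) each $C_\gamma$ has order type at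 most $\kappa$. -/

import Mathlib

universe u

open Cardinal Ordinal Set

noncomputable section

namespace FreshUlt

/-! ### Clubs, limit points and square sequences -/

/-- `C` is a closed unbounded subset of the ordinal `o`. -/
def IsClubIn (C : Set Ordinal.{u}) (o : Ordinal.{u}) : Prop :=
  C ⊆ Iio o ∧ IsClub {x : Iio o | (x : Ordinal.{u}) ∈ C}

/-- `Lim(C)`: the limit ordinals `β` such that `C ∩ β` is unbounded in `β`. -/
def limPts (C : Set Ordinal.{u}) : Set Ordinal.{u} :=
  {β | Order.IsSuccLimit β ∧ ∀ α < β, ∃ c ∈ C, α < c ∧ c < β}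

/-- `⟨C γ | γ ∈ Lim ∩ θ⟩` is a `□(θ)`-sequence; the values of `C` at all other ordinals are
irrelevant. -/
structure IsSquareParenSeq (θ : Cardinal.{u}) (C : Ordinal.{u} → Set Ordinal.{u}) : Prop where
  club : ∀ γ < θ.ord, Order.IsSuccLimit γ → IsClubIn (C γ) γ
  coherent : ∀ γ < θ.ord, Order.IsSuccLimit γ → ∀ β ∈ limPts (C γ), C β = C γ ∩ Iio β
  no_thread : ¬ ∃ D : Set Ordinal.{u}, IsClubIn D θ.ord ∧
    ∀ γ ∈ limPts D, γ < θ.ord → D ∩ Iio γ = C γ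

/-- `⟨C γ | γ ∈ Lim ∩ κ⁺⟩` is a `□_κ`-sequence. -/
structure IsSquareSeq (κ : Cardinal.{u}) (C : Ordinal.{u} → Set Ordinal.{u}) : Prop
    extends IsSquareParenSeq (Order.succ κ) C where
  otp_le : ∀ γ < (Order.succ κ).ord, Order.IsSuccLimit γ →
    Ordinal.type (fun a b : C γ => a < b) ≤ Ordinal.lift.{u + 1} κ.ord

/-! ### Normal ultrafilters on measurable cardinals -/

/-- A normal ultrafilter on the cardinal `δ` (identified with the set of ordinals below `δ`),
where `δ` is uncountable. In particular `δ` is measurable. -/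
structure NormalUltrafilter (δ : Cardinal.{u}) where
  toUltrafilter : Ultrafilter (Iio δ.ord)
  uncountable : ℵ₀ < δ
  /-- `δ`-completeness: closure under intersections of fewer than `δ` members. -/
  complete : CardinalInterFilter (toUltrafilter : Filter (Iio δ.ord)) (Cardinal.lift.{u + 1} δ)
  nonprincipal : ∀ ξ : Iio δ.ord, ({ξ} : Set (Iio δ.ord)) ∉ toUltrafilter
  /-- Normality: closure under diagonal intersections. -/
  diagonal : ∀ X : Iio δ.ord → Set (Iio δ.ord), (∀ ξ, X ξ ∈ toUltrafilter) →
    {η : Iio δ.ord | ∀ ξ < η, η ∈ X ξ} ∈ toUltrafilter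

/-! ### The ultrapower of the universe of sets and its transitive collapse -/

namespace NormalUltrafilter

variable {δ : Cardinal.{u}} (U : NormalUltrafilter δ)

/-- The equivalence classes `[f]_U` of functions `f` from `δ` to the universe of sets. -/
abbrev UltraGerm : Type (u + 1) :=
  Filter.Germ (U.toUltrafilter : Filter (Iio δ.ord)) ZFSet.{u}

/-- Membership of the ultrapower: `[g] E [f]` iff `g ξ ∈ f ξ` for `U`-almost all `ξ`. -/
def ultraMem (y x : U.UltraGerm) : Prop :=
  Filter.Germ.LiftRel (fun a b : ZFSet.{u} => a ∈ b) y x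

theorem ultraMem_wf : WellFounded U.ultraMem := by
  rw [wellFounded_iff_isEmpty_descending_chain]
  refine ⟨fun ⟨e, he⟩ => ?_⟩
  have hout : ∀ n, ∃ f : Iio δ.ord → ZFSet.{u}, (f : U.UltraGerm) = e n := fun n =>
    Filter.Germ.inductionOn (e n) fun f => ⟨f, rfl⟩
  choose f hf using hout
  have hmem : ∀ n, ∀ᶠ ξ in (U.toUltrafilter : Filter (Iio δ.ord)), f (n + 1) ξ ∈ f n ξ := by
    intro n
    have h : U.ultraMem (e (n + 1)) (e n) := he n
    rw [← hf, ← hf] at h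
    exact h
  have hc := U.complete
  have hlt : ℵ₀ < Cardinal.lift.{u + 1} δ := by simpa using U.uncountable
  have : CountableInterFilter (U.toUltrafilter : Filter (Iio δ.ord)) :=
    CardinalInterFilter.toCountableInterFilter _ hlt
  obtain ⟨ξ, hξ⟩ := (eventually_countable_forall.2 hmem).exists
  exact (wellFounded_iff_isEmpty_descending_chain.1 ZFSet.mem_wf).elim ⟨fun n => f n ξ, hξ⟩

instance small_ultraMem (x : U.UltraGerm) : Small.{u} {y // U.ultraMem y x} := by
  induction x using Filter.Germ.inductionOn with
  | _ f =>
    let G : (∀ ξ : Iio δ.ord, (insert ∅ (f ξ) : ZFSet.{u})) → U.UltraGerm :=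
      fun g => ((fun ξ => (g ξ : ZFSet.{u})) : Iio δ.ord → ZFSet.{u})
    have hs : Small.{u} (Set.range G) := inferInstance
    refine @small_subset _ _ _ (fun y hy => ?_) hs
    induction y using Filter.Germ.inductionOn with
    | _ g =>
      classical
      refine ⟨fun ξ => if h : g ξ ∈ f ξ then ⟨g ξ, ZFSet.mem_insert_of_mem _ h⟩
        else ⟨∅, ZFSet.mem_insert _ _⟩, ?_⟩
      refine Filter.Germ.coe_eq.2 ?_
      have hy' : ∀ᶠ ξ in (U.toUltrafilter : Filter (Iio δ.ord)), g ξ ∈ f ξ := hy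
      filter_upwards [hy'] with ξ hξ
      simp [hξ]

/-- The transitive (Mostowski) collapse `π x = {π y | y E x}` of the ultrapower. -/
def collapse : U.UltraGerm → ZFSet.{u} :=
  U.ultraMem_wf.fix fun x π => ZFSet.range fun y : {y // U.ultraMem y x} => π y.1 y.2

theorem mem_collapse {z : ZFSet.{u}} {x : U.UltraGerm} :
    z ∈ U.collapse x ↔ ∃ y, U.ultraMem y x ∧ U.collapse y = z := by
  rw [collapse, WellFounded.fix_eq]
  simp

/-- `Ult(V, U)`, the transitive class that is the range of the collapse. -/
def ult : Set ZFSet.{u} := Set.range U.collapse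

end NormalUltrafilter

/-! ### Freshness -/

/-- The set of ordinals `A`, viewed as a set of von Neumann ordinals, is an element of the
class `M`. -/
def OrdSetMem (A : Set Ordinal.{u}) (M : Set ZFSet.{u}) : Prop :=
  ∃ x ∈ M, (x : Set ZFSet.{u}) = Ordinal.toZFSet '' A

/-- The set `A` of ordinals is fresh over the class `M`. Boundedness says that `A` is a set (and
not a proper class) of ordinals. -/
def IsFresh (M : Set ZFSet.{u}) (A : Set Ordinal.{u}) : Prop :=
  BddAbove A ∧ ¬ OrdSetMem A M ∧ ∀ α < sSup A, OrdSetMem (A ∩ Iio α) M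

end FreshUlt

end

/-! Write `[f]` for the ordinal that `f` represents. As κ has cofinality δ and λ^δ < κ below κ,
there is `k : δ → κ` with `[k] = κ`, and then `[ξ ↦ |k ξ|⁺] = κ⁺` (`exists_ordOf_eq_ord`,
`ordOf_succ_eq`). Hence the forcing of closed bounded subsets of κ⁺ in the ultrapower is represented
by posets `P ξ` of closed bounded subsets of `|k ξ|⁺`, in which chains of size at most `|k ξ|` have
upper bounds.

In V, a κ⁺-sequence `F` in the product of the `P ξ` is built, increasing modulo U; the union of the
sets it represents is the club. Step γ + 1 makes it disagree with the γ-th of the 2^κ = κ⁺ sequences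
of subsets of κ, so it is not in the ultrapower, while each initial segment is read off from a
single `F α`.

The square sequence carries `F` through limits. The induction also demands `F β ξ ≤ F γ ξ` for every
limit point β < γ of C_γ and every ξ with otp C_γ < `k ξ`. At a coordinate ξ, the limit points β of
C_γ with otp C_β < `k ξ` then index a genuine chain of size at most `|k ξ|`, which has a bound; and
otp C_β < κ, so almost every ξ takes β into account. If the limit points are bounded in γ, then γ
has countable cofinality and countable completeness suffices (`LimitSystem.exists_next`). -/

noncomputable section

namespace FreshUlt

/-! ### Ordinals and sets of ordinals in the ultrapower -/

namespace NormalUltrafilter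

open Filter

variable {δ : Cardinal.{u}} (U : NormalUltrafilter δ)

/-- `U.AE p` says that `p` holds on a set of indices in `U`. -/
abbrev AE (p : Iio δ.ord → Prop) : Prop :=
  ∀ᶠ ξ in (U.toUltrafilter : Filter (Iio δ.ord)), p ξ

/-- If inclusion failed on a set in U, choosing a point of each difference would give a germ in the
first class but not in the second. -/
theorem ae_subset_of_forall_ultraMem {f g : Iio δ.ord → ZFSet.{u}}
    (h : ∀ y, U.ultraMem y (f : U.UltraGerm) → U.ultraMem y (g : U.UltraGerm)) :
    U.AE fun ξ => f ξ ⊆ g ξ := by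
  by_contra hn
  rw [AE, ← Ultrafilter.eventually_not] at hn
  have : ∀ ξ, ∃ w, ¬ f ξ ⊆ g ξ → w ∈ f ξ ∧ w ∉ g ξ := fun ξ => by
    by_cases hs : f ξ ⊆ g ξ
    · exact ⟨∅, fun h' => absurd hs h'⟩
    · have h' := hs
      rw [ZFSet.subset_def] at h'
      push Not at h'
      obtain ⟨w, hw⟩ := h'
      exact ⟨w, fun _ => hw⟩
  choose w hw using this
  have hg : U.AE fun ξ => w ξ ∈ g ξ :=
    h (w : U.UltraGerm) (hn.mono fun ξ hξ => (hw ξ hξ).1)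
  obtain ⟨ξ, h1, h2⟩ := (hg.and hn).exists
  exact (hw ξ h2).2 h1

theorem collapse_injective : Function.Injective U.collapse := by
  intro x
  induction x using U.ultraMem_wf.induction with
  | _ x ih =>
    intro z hxz
    have h₁ : ∀ y, U.ultraMem y x → U.ultraMem y z := fun y hy => by
      have hmem : U.collapse y ∈ U.collapse z := hxz ▸ U.mem_collapse.2 ⟨_, hy, rfl⟩
      obtain ⟨w, hw, hwy⟩ := U.mem_collapse.1 hmem
      exact ih _ hy hwy.symm ▸ hw
    have h₂ : ∀ y, U.ultraMem y z → U.ultraMem y x := fun y hy => by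
      have hmem : U.collapse y ∈ U.collapse x := hxz ▸ U.mem_collapse.2 ⟨_, hy, rfl⟩
      obtain ⟨w, hw, hwy⟩ := U.mem_collapse.1 hmem
      exact ih _ hw hwy ▸ hw
    induction x using Germ.inductionOn with
    | _ f =>
    induction z using Germ.inductionOn with
    | _ g =>
    refine Germ.coe_eq.2 ?_
    filter_upwards [U.ae_subset_of_forall_ultraMem h₁, U.ae_subset_of_forall_ultraMem h₂]
      with ξ h1 h2
    exact ZFSet.ext fun z => ⟨fun h => h1 h, fun h => h2 h⟩

theorem collapse_mem_collapse_iff {f g : Iio δ.ord → ZFSet.{u}} :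
    U.collapse (g : U.UltraGerm) ∈ U.collapse (f : U.UltraGerm) ↔ U.AE fun ξ => g ξ ∈ f ξ := by
  refine ⟨fun h => ?_, fun h => U.mem_collapse.2 ⟨(g : U.UltraGerm), h, rfl⟩⟩
  obtain ⟨y, hy, hyg⟩ := U.mem_collapse.1 h
  obtain rfl := U.collapse_injective hyg
  exact hy

theorem exists_of_mem_collapse {f : Iio δ.ord → ZFSet.{u}} {z : ZFSet.{u}}
    (h : z ∈ U.collapse (f : U.UltraGerm)) :
    ∃ g : Iio δ.ord → ZFSet.{u}, U.collapse (g : U.UltraGerm) = z ∧ U.AE fun ξ => g ξ ∈ f ξ := by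
  obtain ⟨y, hy, hyz⟩ := U.mem_collapse.1 h
  induction y using Germ.inductionOn with
  | _ g => exact ⟨g, hyz, hy⟩

/-- The germ of the von Neumann ordinals `f ξ`. -/
def ordGerm (f : Iio δ.ord → Ordinal.{u}) : U.UltraGerm :=
  ((fun ξ => (f ξ).toZFSet : Iio δ.ord → ZFSet.{u}) : U.UltraGerm)

theorem exists_of_mem_collapse_ordGerm {f : Iio δ.ord → Ordinal.{u}} {z : ZFSet.{u}}
    (h : z ∈ U.collapse (U.ordGerm f)) :
    ∃ g : Iio δ.ord → Ordinal.{u}, U.collapse (U.ordGerm g) = z ∧ U.AE fun ξ => g ξ < f ξ := by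
  obtain ⟨g, rfl, hg⟩ := U.exists_of_mem_collapse h
  have hg' : U.AE fun ξ => (g ξ).rank.toZFSet = g ξ ∧ (g ξ).rank < f ξ := by
    filter_upwards [hg] with ξ hξ
    obtain ⟨a, ha, hag⟩ := Ordinal.mem_toZFSet_iff.1 hξ
    rw [← hag, Ordinal.rank_toZFSet]
    exact ⟨rfl, ha⟩
  refine ⟨fun ξ => (g ξ).rank, congrArg _ (Germ.coe_eq.2 (hg'.mono fun ξ h => h.1)),
    hg'.mono fun ξ h => h.2⟩

theorem isOrdinal_collapse_ordGerm (f : Iio δ.ord → Ordinal.{u}) :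
    (U.collapse (U.ordGerm f)).IsOrdinal := by
  rw [ZFSet.isOrdinal_iff_forall_mem_isTransitive]
  have key : ∀ f : Iio δ.ord → Ordinal.{u}, (U.collapse (U.ordGerm f)).IsTransitive := by
    intro f y hy z hz
    obtain ⟨g, rfl, hg⟩ := U.exists_of_mem_collapse_ordGerm hy
    obtain ⟨h, rfl, hh⟩ := U.exists_of_mem_collapse_ordGerm hz
    refine U.collapse_mem_collapse_iff.2 ?_
    filter_upwards [hg, hh] with ξ h1 h2
    exact Ordinal.toZFSet_mem_toZFSet_iff.2 (h2.trans h1)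
  refine ⟨key f, fun y hy => ?_⟩
  obtain ⟨g, rfl, -⟩ := U.exists_of_mem_collapse_ordGerm hy
  exact key g

/-- The ordinal represented by a function `f` in the ultrapower. -/
def ordOf (f : Iio δ.ord → Ordinal.{u}) : Ordinal.{u} := (U.collapse (U.ordGerm f)).rank

theorem toZFSet_ordOf (f : Iio δ.ord → Ordinal.{u}) :
    (U.ordOf f).toZFSet = U.collapse (U.ordGerm f) :=
  (U.isOrdinal_collapse_ordGerm f).toZFSet_rank_eq

theorem ordOf_lt_iff {f g : Iio δ.ord → Ordinal.{u}} :
    U.ordOf f < U.ordOf g ↔ U.AE fun ξ => f ξ < g ξ := by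
  rw [← Ordinal.toZFSet_mem_toZFSet_iff, toZFSet_ordOf, toZFSet_ordOf, ordGerm, ordGerm,
    collapse_mem_collapse_iff]
  simp only [Ordinal.toZFSet_mem_toZFSet_iff]

theorem ordOf_le_iff {f g : Iio δ.ord → Ordinal.{u}} :
    U.ordOf f ≤ U.ordOf g ↔ U.AE fun ξ => f ξ ≤ g ξ := by
  rw [← not_lt, ordOf_lt_iff, AE, ← Ultrafilter.eventually_not]
  simp only [not_lt]

theorem ordOf_eq_iff {f g : Iio δ.ord → Ordinal.{u}} :
    U.ordOf f = U.ordOf g ↔ U.AE fun ξ => f ξ = g ξ := by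
  simp only [le_antisymm_iff, ordOf_le_iff, eventually_and]

theorem exists_of_lt_ordOf {f : Iio δ.ord → Ordinal.{u}} {ν : Ordinal.{u}} (h : ν < U.ordOf f) :
    ∃ g : Iio δ.ord → Ordinal.{u}, U.ordOf g = ν ∧ U.AE fun ξ => g ξ < f ξ := by
  rw [← Ordinal.toZFSet_mem_toZFSet_iff, toZFSet_ordOf] at h
  obtain ⟨g, hg, hlt⟩ := U.exists_of_mem_collapse_ordGerm h
  exact ⟨g, by rw [ordOf, hg, Ordinal.rank_toZFSet], hlt⟩

theorem le_ordOf_const (ν : Ordinal.{u}) : ν ≤ U.ordOf fun _ => ν := by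
  have : StrictMono fun ν : Ordinal.{u} => U.ordOf fun _ => ν := fun a b h =>
    U.ordOf_lt_iff.2 (Eventually.of_forall fun _ => h)
  exact this.le_apply

/-- The constant function at ν represents an ordinal at least ν, and the represented ordinals are
closed downwards. -/
theorem ordOf_surjective : Function.Surjective U.ordOf := by
  intro ν
  rcases (U.le_ordOf_const ν).eq_or_lt with h | h
  · exact ⟨_, h.symm⟩
  · obtain ⟨g, hg, -⟩ := U.exists_of_lt_ordOf h
    exact ⟨g, hg⟩

/-- The set of ordinals represented by a sequence of sets of ordinals in the ultrapower. -/
def ordSetOf (a : Iio δ.ord → Set Ordinal.{u}) : Set Ordinal.{u} :=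
  {ν | ∃ g, U.ordOf g = ν ∧ U.AE fun ξ => g ξ ∈ a ξ}

theorem ordOf_mem_ordSetOf_iff {a : Iio δ.ord → Set Ordinal.{u}} {g : Iio δ.ord → Ordinal.{u}} :
    U.ordOf g ∈ U.ordSetOf a ↔ U.AE fun ξ => g ξ ∈ a ξ := by
  refine ⟨?_, fun h => ⟨g, rfl, h⟩⟩
  rintro ⟨f, hfg, hf⟩
  filter_upwards [U.ordOf_eq_iff.1 hfg, hf] with ξ h1 h2
  exact h1 ▸ h2

theorem ordSetMem_ordSetOf (a : Iio δ.ord → Set Ordinal.{u}) (ha : ∀ ξ, BddAbove (a ξ)) :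
    OrdSetMem (U.ordSetOf a) U.ult := by
  have hsmall (ξ) : Small.{u} (a ξ) := Ordinal.bddAbove_iff_small.1 (ha ξ)
  let f : Iio δ.ord → ZFSet.{u} := fun ξ => ZFSet.range fun x : a ξ => (x : Ordinal.{u}).toZFSet
  have hf : ∀ ξ z, z ∈ f ξ ↔ ∃ x ∈ a ξ, x.toZFSet = z := fun ξ z => by simp [f]
  refine ⟨U.collapse (f : U.UltraGerm), ⟨_, rfl⟩, ?_⟩
  ext z
  constructor
  · intro hz
    obtain ⟨g, rfl, hg⟩ := U.exists_of_mem_collapse (SetLike.mem_coe.1 hz)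
    have hg' : U.AE fun ξ => (g ξ).rank ∈ a ξ ∧ (g ξ).rank.toZFSet = g ξ := by
      filter_upwards [hg] with ξ hξ
      obtain ⟨x, hx, hxg⟩ := (hf _ _).1 hξ
      rw [← hxg, Ordinal.rank_toZFSet]
      exact ⟨hx, rfl⟩
    refine ⟨U.ordOf fun ξ => (g ξ).rank, ⟨_, rfl, hg'.mono fun ξ h => h.1⟩, ?_⟩
    rw [toZFSet_ordOf]
    exact congrArg _ (Germ.coe_eq.2 (hg'.mono fun ξ h => h.2))
  · rintro ⟨_, ⟨g, rfl, hg⟩, rfl⟩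
    rw [toZFSet_ordOf]
    refine SetLike.mem_coe.2 (U.collapse_mem_collapse_iff.2 ?_)
    filter_upwards [hg] with ξ hξ
    exact (hf _ _).2 ⟨_, hξ, rfl⟩

theorem exists_ordSetOf_of_ordSetMem {A : Set Ordinal.{u}} (h : OrdSetMem A U.ult) :
    ∃ a : Iio δ.ord → Set Ordinal.{u}, A = U.ordSetOf a := by
  obtain ⟨_, ⟨y, rfl⟩, hA⟩ := h
  induction y using Germ.inductionOn with
  | _ f =>
  refine ⟨fun ξ => {x | x.toZFSet ∈ f ξ}, ?_⟩
  ext ν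
  obtain ⟨g, rfl⟩ := U.ordOf_surjective ν
  rw [ordOf_mem_ordSetOf_iff, ← Ordinal.toZFSet_injective.mem_set_image, ← hA, SetLike.mem_coe,
    toZFSet_ordOf, ordGerm, collapse_mem_collapse_iff]
  rfl

end NormalUltrafilter

/-! ### Chains modulo a filter along a limit system -/

/-- Transitive systems `L` of sets of predecessors below `Λ`, ranked by `t` with ranks at most `τ`:
if `L γ` is bounded in the limit ordinal `γ`, then `γ` has countable cofinality, as witnessed by a
sequence that starts with the maximum of `L γ`, if there is one. -/
structure LimitSystem (Λ τ : Ordinal.{u}) (L : Ordinal.{u} → Set Ordinal.{u})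
    (t : Ordinal.{u} → Ordinal.{u}) : Prop where
  isSuccLimit : ∀ γ, ∀ β ∈ L γ, Order.IsSuccLimit γ
  lt : ∀ γ, ∀ β ∈ L γ, β < γ
  coherent : ∀ γ < Λ, ∀ β' ∈ L γ, ∀ β ∈ L γ, β < β' → β ∈ L β'
  rank_lt : ∀ γ < Λ, ∀ β ∈ L γ, t β < t γ
  rank_le : ∀ γ < Λ, Order.IsSuccLimit γ → t γ ≤ τ
  exists_seq : ∀ γ < Λ, Order.IsSuccLimit γ → (∃ α < γ, ∀ β ∈ L γ, β ≤ α) →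
    ∃ e : ℕ → Ordinal.{u}, (∀ n, e n < γ) ∧ StrictMono e ∧ (∀ α < γ, ∃ n, α < e n) ∧
      ∀ β ∈ L γ, β = e 0 ∨ β < e 0 ∧ e 0 ∈ L γ

section Construction

variable {Λ τ : Ordinal.{u}} {L : Ordinal.{u} → Set Ordinal.{u}} {t : Ordinal.{u} → Ordinal.{u}}
  {I : Type*} {l : Filter I} [CountableInterFilter l] {P : I → Type (u + 1)}
  [∀ i, Preorder (P i)] {k : I → Ordinal.{u}}

/-- `hA` is the order modulo the filter; `hB` is the pointwise control along `L` that makes limit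
steps possible. -/
theorem LimitSystem.exists_next (hL : LimitSystem Λ τ L t) (hk : ∀ ξ < τ, ∀ᶠ i in l, ξ < k i)
    (hω : ∀ i, ω ≤ k i)
    (hub : ∀ i (S : Set (P i)), IsChain (· ≤ ·) S → #S ≤ Cardinal.lift.{u + 1} (k i).card →
      ∃ b, ∀ s ∈ S, s ≤ b)
    (ext : Ordinal.{u} → (∀ i, P i) → ∀ i, P i) (hext : ∀ γ p, p ≤ ext γ p)
    {γ : Ordinal.{u}} (hγ : γ < Λ) (F : Ordinal.{u} → ∀ i, P i)
    (hA : ∀ β' < γ, ∀ β < β', ∀ᶠ i in l, F β i ≤ F β' i)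
    (hB : ∀ β' < γ, ∀ β ∈ L β', ∀ i, t β' < k i → F β i ≤ F β' i) :
    ∃ x : ∀ i, P i, (∀ β < γ, ∀ᶠ i in l, F β i ≤ x i) ∧
      (∀ β ∈ L γ, ∀ i, t γ < k i → F β i ≤ x i) ∧ ∀ β, γ = β + 1 → x = ext β (F β) := by
  rcases Ordinal.zero_or_succ_or_isSuccLimit γ with rfl | ⟨β, rfl⟩ | hlim
  · refine ⟨F 0, fun β hβ => absurd hβ not_lt_zero, fun β hβ => absurd (hL.lt _ _ hβ) not_lt_zero,
      fun β hβ => absurd hβ.symm ?_⟩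
    simp
  · refine ⟨ext β (F β), fun β' hβ' => ?_, fun β' hβ' => ?_, fun β' h => ?_⟩
    · rcases (Order.lt_succ_iff.1 hβ').eq_or_lt with rfl | h
      · exact Filter.Eventually.of_forall (hext _ _)
      · exact (hA β (Order.lt_succ β) β' h).mono fun i hi => hi.trans (hext _ _ i)
    · exact absurd (hL.isSuccLimit _ _ hβ') (Order.not_isSuccLimit_succ _)
    · obtain rfl : β = β' := Order.succ_injective h
      rfl
  have hsucc : ∀ (x : ∀ i, P i) β, γ = β + 1 → x = ext β (F β) := fun x β h =>
    by
    rw [h, ← Order.succ_eq_add_one] at hlim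
    exact absurd hlim (Order.not_isSuccLimit_succ _)
  by_cases hb : ∃ α < γ, ∀ β ∈ L γ, β ≤ α
  · obtain ⟨e, he, hmono, hcof, he0⟩ := hL.exists_seq γ hγ hlim hb
    -- The sequence increases only at almost every `i`; elsewhere `F (e 0) i` serves. Lying above `F
    -- (e 0)` everywhere gives the pointwise demand, since `e 0` is the maximum of a nonempty `L γ`.
    have : ∀ i, ∃ x : P i, F (e 0) i ≤ x ∧
        ((∀ n, F (e n) i ≤ F (e (n + 1)) i) → ∀ n, F (e n) i ≤ x) := by
      intro i
      by_cases h : ∀ n, F (e n) i ≤ F (e (n + 1)) i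
      · obtain ⟨b, hbd⟩ := hub i (range fun n => F (e n) i)
          (monotone_nat_of_le_succ h).isChain_range
          ((Cardinal.mk_le_aleph0_iff.2 (countable_range _).to_subtype).trans
            (Cardinal.aleph0_le_lift.2 (Ordinal.aleph0_le_card.2 (hω i))))
        exact ⟨b, hbd _ ⟨0, rfl⟩, fun _ n => hbd _ ⟨n, rfl⟩⟩
      · exact ⟨F (e 0) i, le_rfl, fun h' => absurd h' h⟩
    choose x hx0 hx using this
    refine ⟨x, fun β hβ => ?_, fun β hβ i hi => ?_, hsucc x⟩
    · obtain ⟨n, hn⟩ := hcof β hβ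
      have hall : ∀ᶠ i in l, ∀ n, F (e n) i ≤ F (e (n + 1)) i :=
        eventually_countable_forall.2 fun n => hA _ (he _) _ (hmono n.lt_succ_self)
      filter_upwards [hall, hA _ (he n) _ hn] with i h1 h2
      exact h2.trans (hx i h1 n)
    · rcases he0 β hβ with rfl | ⟨h1, h2⟩
      · exact hx0 i
      · exact (hB _ (he 0) _ (hL.coherent γ hγ _ h2 _ hβ h1) i
          ((hL.rank_lt γ hγ _ h2).trans hi)).trans (hx0 i)
  · push Not at hb
    have : ∀ i, ∃ x : P i, ∀ β ∈ L γ, t β < k i → F β i ≤ x := by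
      intro i
      -- The cut-off is on `t β`, not `t γ`: the latter may equal `τ`, whereas `t β < τ` puts each
      -- `β` in `T` for almost every `i`. Ranks increase strictly along `L γ`, so `T` has size at
      -- most `|k i|`.
      let T : Set Ordinal.{u} := {β | β ∈ L γ ∧ t β < k i}
      have hle : ∀ β ∈ T, ∀ β' ∈ T, β < β' → F β i ≤ F β' i := fun β h β' h' hlt =>
        hB _ (hL.lt _ _ h'.1) _ (hL.coherent γ hγ _ h'.1 _ h.1 hlt) i h'.2
      have hchain : IsChain (· ≤ ·) ((fun β => F β i) '' T) := by
        rintro _ ⟨β, h, rfl⟩ _ ⟨β', h', rfl⟩ hne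
        rcases lt_trichotomy β β' with hlt | rfl | hlt
        · exact Or.inl (hle _ h _ h' hlt)
        · exact absurd rfl hne
        · exact Or.inr (hle _ h' _ h hlt)
      have hinj : InjOn t T := by
        intro β h β' h' heq
        rcases lt_trichotomy β β' with hlt | rfl | hlt
        · exact absurd heq (hL.rank_lt _ ((hL.lt _ _ h'.1).trans hγ) _
            (hL.coherent γ hγ _ h'.1 _ h.1 hlt)).ne
        · rfl
        · exact absurd heq (hL.rank_lt _ ((hL.lt _ _ h.1).trans hγ) _
            (hL.coherent γ hγ _ h.1 _ h'.1 hlt)).ne'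
      have hcard : #T ≤ #(Iio (k i)) := by
        rw [← Cardinal.mk_image_eq_of_injOn _ _ hinj]
        exact Cardinal.mk_le_mk_of_subset (by rintro _ ⟨β, h, rfl⟩; exact h.2)
      rw [Cardinal.mk_Iio_ordinal] at hcard
      obtain ⟨b, hbd⟩ := hub i _ hchain (Cardinal.mk_image_le.trans hcard)
      exact ⟨b, fun β h1 h2 => hbd _ ⟨β, ⟨h1, h2⟩, rfl⟩⟩
    choose x hx using this
    refine ⟨x, fun β hβ => ?_, fun β hβ i hi => hx i β hβ ((hL.rank_lt γ hγ β hβ).trans hi),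
      hsucc x⟩
    obtain ⟨β', hβ', hlt⟩ := hb β hβ
    filter_upwards [hk _ ((hL.rank_lt γ hγ _ hβ').trans_le (hL.rank_le γ hγ hlim)),
      hA _ (hL.lt _ _ hβ') _ hlt] with i h1 h2
    exact h2.trans (hx i β' hβ' h1)

theorem LimitSystem.exists_chain (hL : LimitSystem Λ τ L t)
    (hk : ∀ ξ < τ, ∀ᶠ i in l, ξ < k i) (hω : ∀ i, ω ≤ k i)
    (hub : ∀ i (S : Set (P i)), IsChain (· ≤ ·) S → #S ≤ Cardinal.lift.{u + 1} (k i).card →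
      ∃ b, ∀ s ∈ S, s ≤ b)
    (ext : Ordinal.{u} → (∀ i, P i) → ∀ i, P i) (hext : ∀ γ p, p ≤ ext γ p) :
    ∃ F : Ordinal.{u} → ∀ i, P i,
      (∀ γ < Λ, ∀ β < γ, ∀ᶠ i in l, F β i ≤ F γ i) ∧
      ∀ γ, γ + 1 < Λ → F (γ + 1) = ext γ (F γ) := by
  classical
  have hne : ∀ i, Nonempty (P i) := fun i => by
    obtain ⟨b, -⟩ := hub i ∅ IsChain.empty (by simp)
    exact ⟨b⟩
  let p₀ : ∀ i, P i := fun i => (hne i).some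
  have : Nonempty (∀ i, P i) := ⟨p₀⟩
  let good : Ordinal.{u} → (Ordinal.{u} → ∀ i, P i) → (∀ i, P i) → Prop := fun γ G x =>
    (∀ β < γ, ∀ᶠ i in l, G β i ≤ x i) ∧
      (∀ β ∈ L γ, ∀ i, t γ < k i → G β i ≤ x i) ∧ ∀ β, γ = β + 1 → x = ext β (G β)
  let ρ : ∀ γ : Ordinal.{u}, (∀ β < γ, ∀ i, P i) → Ordinal.{u} → ∀ i, P i := fun γ G β =>
    if h : β < γ then G β h else p₀
  -- A good value exists only when the earlier values are good, so the recursion picks by `epsilon`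
  -- and goodness is proved afterwards by induction.
  let F : Ordinal.{u} → ∀ i, P i :=
    (wellFounded_lt (α := Ordinal.{u})).fix fun γ G => Classical.epsilon (good γ (ρ γ G))
  have hF : ∀ γ, F γ = Classical.epsilon (good γ (ρ γ fun β _ => F β)) := fun γ =>
    WellFounded.fix_eq _ _ _
  have hρ : ∀ γ, ∀ β < γ, ρ γ (fun β _ => F β) β = F β := fun γ β h => dif_pos h
  have hgood : ∀ γ < Λ, good γ F (F γ) := by
    intro γ
    induction γ using WellFoundedLT.induction with
    | _ γ ih =>
      intro hγ
      obtain ⟨x, hx1, hx2, hx3⟩ := hL.exists_next hk hω hub ext hext hγ F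
        (fun β' h => (ih β' h (h.trans hγ)).1) (fun β' h => (ih β' h (h.trans hγ)).2.1)
      have hiff : ∀ y, good γ (ρ γ fun β _ => F β) y ↔ good γ F y := fun y => by
        refine and_congr (forall₂_congr fun β h => by rw [hρ γ β h])
          (and_congr (forall₂_congr fun β h => by rw [hρ γ β (hL.lt _ _ h)])
            (forall₂_congr fun β h => ?_))
        rw [hρ γ β (h ▸ Order.lt_succ β)]
      rw [← hiff]
      have hs := Classical.epsilon_spec (p := good γ (ρ γ fun β _ => F β))
        ⟨x, (hiff x).2 ⟨hx1, hx2, hx3⟩⟩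
      rwa [← hF] at hs
  exact ⟨F, fun γ h => (hgood γ h).1, fun γ h => (hgood _ h).2.2 γ rfl⟩

end Construction

/-! ### Limit points of a square sequence -/

theorem IsClubIn.exists_gt {C : Set Ordinal.{u}} {γ α : Ordinal.{u}} (hC : IsClubIn C γ)
    (hγ : Order.IsSuccLimit γ) (hα : α < γ) : ∃ c ∈ C, α < c ∧ c < γ := by
  obtain ⟨b, hb, hab⟩ := hC.2.isCofinal ⟨Order.succ α, hγ.succ_lt hα⟩
  exact ⟨b, hb, Order.succ_le_iff.1 hab, b.2⟩

theorem type_lt_type_of_eq_inter {A B : Set Ordinal.{u}} {β c : Ordinal.{u}} (h : A = B ∩ Iio β)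
    (hc : c ∈ B) (hβ : β ≤ c) :
    Ordinal.type (fun a b : A => a < b) < Ordinal.type (fun a b : B => a < b) := by
  subst h
  refine lt_of_le_of_lt ?_ (Ordinal.typein_lt_type (fun a b : B => a < b) ⟨c, hc⟩)
  refine Ordinal.type_le_iff'.2 ⟨⟨⟨fun x => ⟨⟨x.1, x.2.1⟩, ?_⟩, fun x y hxy => ?_⟩, ?_⟩⟩
  · exact Subtype.mk_lt_mk.2 (lt_of_lt_of_le x.2.2 hβ)
  · simpa [Subtype.ext_iff] using hxy
  · intro x y
    rfl

theorem exists_strictMono_seq {C : Set Ordinal.{u}} {γ α : Ordinal.{u}} (hC : IsClubIn C γ)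
    (hγ : Order.IsSuccLimit γ) (hα : α < γ) :
    ∃ e : ℕ → Ordinal.{u}, e 0 = α ∧ (∀ n, e n < γ) ∧ StrictMono e ∧ ∀ n, e (n + 1) ∈ C := by
  choose f hf using fun x : Iio γ => hC.exists_gt hγ x.2
  let e : ℕ → Iio γ := fun n => n.rec ⟨α, hα⟩ fun _ x => ⟨f x, (hf x).2.2⟩
  let d : ℕ → Ordinal.{u} := fun n => (e n).1
  have hmono : StrictMono d := strictMono_nat_of_lt_succ fun n => (hf (e n)).2.1
  exact ⟨d, rfl, fun n => (e n).2, hmono, fun n => (hf (e n)).1⟩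

theorem isSuccLimit_iSup_of_strictMono {e : ℕ → Ordinal.{u}} (he : StrictMono e) :
    Order.IsSuccLimit (⨆ n, e n) := by
  rw [Ordinal.isSuccLimit_iff, Order.isSuccPrelimit_iff_succ_lt]
  have hlt : ∀ n, e n < ⨆ n, e n := fun n =>
    (he n.lt_succ_self).trans_le (Ordinal.le_iSup e (n + 1))
  refine ⟨(bot_le.trans_lt (hlt 0)).ne', fun b hb => ?_⟩
  obtain ⟨n, hn⟩ := Ordinal.lt_iSup_iff.1 hb
  exact (Order.succ_le_of_lt hn).trans_lt (hlt n)

theorem sup_mem_limPts {C : Set Ordinal.{u}} {e : ℕ → Ordinal.{u}} (he : StrictMono e)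
    (hC : ∀ n, e (n + 1) ∈ C) : ⨆ n, e n ∈ limPts C := by
  refine ⟨isSuccLimit_iSup_of_strictMono he, fun α hα => ?_⟩
  obtain ⟨n, hn⟩ := Ordinal.lt_iSup_iff.1 hα
  exact ⟨e (n + 1), hC n, hn.trans (he n.lt_succ_self),
    (he (n + 1).lt_succ_self).trans_le (Ordinal.le_iSup e (n + 2))⟩

theorem limPts_inter_Iio {C : Set Ordinal.{u}} {β β' : Ordinal.{u}} (h : β ∈ limPts C)
    (hlt : β < β') : β ∈ limPts (C ∩ Iio β') :=
  ⟨h.1, fun α hα =>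
    let ⟨c, hc, h1, h2⟩ := h.2 α hα
    ⟨c, ⟨hc, h2.trans hlt⟩, h1, h2⟩⟩

theorem sSup_mem_limPts {C S : Set Ordinal.{u}} (hS : S ⊆ limPts C) (hne : S.Nonempty)
    (hb : BddAbove S) : sSup S ∈ limPts C := by
  by_cases hmem : sSup S ∈ S
  · exact hS hmem
  have hlt : ∀ β ∈ S, β < sSup S := fun β hβ =>
    (le_csSup hb hβ).lt_of_ne fun h => hmem (h ▸ hβ)
  have key : ∀ α < sSup S, ∃ c ∈ C, α < c ∧ c < sSup S := fun α hα => by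
    obtain ⟨β, hβ, hαβ⟩ := exists_lt_of_lt_csSup hne hα
    obtain ⟨c, hc, h1, h2⟩ := (hS hβ).2 α hαβ
    exact ⟨c, hc, h1, h2.trans (hlt β hβ)⟩
  refine ⟨?_, key⟩
  rw [Ordinal.isSuccLimit_iff, Order.isSuccPrelimit_iff_succ_lt]
  obtain ⟨β, hβ⟩ := hne
  refine ⟨(bot_le.trans_lt (hlt β hβ)).ne', fun α hα => ?_⟩
  obtain ⟨c, -, h1, h2⟩ := key α hα
  exact (Order.succ_le_of_lt h1).trans_lt h2

/-- `L γ` consists of the limit points of `C γ` below `γ`, and `t γ` is the order type of `C γ`;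
coherence makes `C β` a proper initial segment of `C γ`. -/
theorem IsSquareSeq.exists_limitSystem {κ : Cardinal.{u}} {C : Ordinal.{u} → Set Ordinal.{u}}
    (hC : IsSquareSeq κ C) :
    ∃ (L : Ordinal.{u} → Set Ordinal.{u}) (t : Ordinal.{u} → Ordinal.{u}),
      LimitSystem (Order.succ κ).ord κ.ord L t := by
  have : ∀ γ, ∃ o : Ordinal.{u}, γ < (Order.succ κ).ord → Order.IsSuccLimit γ →
      Ordinal.lift.{u + 1} o = Ordinal.type fun a b : C γ => a < b := fun γ => by
    by_cases h : γ < (Order.succ κ).ord ∧ Order.IsSuccLimit γ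
    · obtain ⟨o, ho⟩ := Ordinal.mem_range_lift_of_le (hC.otp_le γ h.1 h.2)
      exact ⟨o, fun _ _ => ho⟩
    · exact ⟨0, fun h1 h2 => absurd ⟨h1, h2⟩ h⟩
  choose t ht using this
  have hcoh : ∀ γ < (Order.succ κ).ord, Order.IsSuccLimit γ → ∀ β ∈ limPts (C γ), β < γ →
      ∀ α ∈ limPts (C γ), α < β → α ∈ limPts (C β) := fun γ h1 h2 β hβ hlt α hα hαβ => by
    rw [hC.coherent γ h1 h2 β hβ]
    exact limPts_inter_Iio hα hαβ
  refine ⟨fun γ => {β | Order.IsSuccLimit γ ∧ β ∈ limPts (C γ) ∧ β < γ}, t,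
    fun γ β h => h.1, fun γ β h => h.2.2, ?_, ?_, ?_, ?_⟩
  · rintro γ hγ β' ⟨h1, h2, h3⟩ β ⟨-, h5, -⟩ hlt
    exact ⟨h2.1, hcoh γ hγ h1 _ h2 h3 _ h5 hlt, hlt⟩
  · rintro γ hγ β ⟨h1, h2, h3⟩
    rw [← Ordinal.lift_lt.{u + 1}, ht γ hγ h1, ht β (h3.trans hγ) h2.1]
    obtain ⟨c, hc, hβc, -⟩ := (hC.club γ hγ h1).exists_gt h1 h3
    exact type_lt_type_of_eq_inter (hC.coherent γ hγ h1 β h2) hc hβc.le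
  · intro γ hγ h1
    rw [← Ordinal.lift_le.{u + 1}, ht γ hγ h1]
    exact hC.otp_le γ hγ h1
  · rintro γ hγ h1 ⟨α, hα, hle⟩
    let S : Set Ordinal.{u} := {β | Order.IsSuccLimit γ ∧ β ∈ limPts (C γ) ∧ β < γ}
    have hbdd : BddAbove S := ⟨α, hle⟩
    have hs : sSup S < γ := (csSup_le' hle).trans_lt hα
    obtain ⟨e, he0, heγ, hmono, heC⟩ := exists_strictMono_seq (hC.club γ hγ h1) h1 hs
    refine ⟨e, heγ, hmono, fun α' hα' => ?_, fun β hβ => ?_⟩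
    -- Otherwise the supremum of `e` is a limit point of `C γ` below `γ` and above `sSup S`.
    · by_contra! hcon
      have hsup : ⨆ n, e n < γ := (Ordinal.iSup_le hcon).trans_lt hα'
      have h2 : ⨆ n, e n ∈ S := ⟨h1, sup_mem_limPts hmono heC, hsup⟩
      have h3 := (hmono Nat.zero_lt_one).trans_le (Ordinal.le_iSup e 1)
      rw [he0] at h3
      exact absurd (le_csSup hbdd h2) h3.not_ge
    · rw [he0]
      rcases (le_csSup hbdd hβ).eq_or_lt with h | h
      · exact Or.inl h
      · exact Or.inr ⟨h, h1, sSup_mem_limPts (fun x hx => hx.2.1) ⟨β, hβ⟩ hbdd, hs⟩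

/-! ### The poset of closed bounded sets -/

/-- Closed sets of ordinals below `μ` that contain `0` and have a maximum. -/
structure ClosedCond (μ : Ordinal.{u}) where
  carrier : Set Ordinal.{u}
  top : Ordinal.{u}
  zero_mem : 0 ∈ carrier
  top_mem : top ∈ carrier
  le_top : ∀ x ∈ carrier, x ≤ top
  top_lt : top < μ
  closed : ∀ x, x ∉ carrier → ∃ y < x, ∀ z ∈ carrier, z < x → z ≤ y

namespace ClosedCond

variable {μ : Ordinal.{u}}

/-- Conditions are ordered by end-extension. -/
instance : Preorder (ClosedCond μ) where
  le p q := p.carrier = q.carrier ∩ Iic p.top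
  le_refl p := (inter_eq_left.2 p.le_top).symm
  le_trans p q r hpq hqr := by
    have h : p.top ≤ q.top := q.le_top _ (hpq ▸ p.top_mem : p.top ∈ q.carrier ∩ _).1
    change p.carrier = r.carrier ∩ Iic p.top
    rw [hpq, hqr, inter_assoc, Iic_inter_Iic, min_eq_right h]

theorem le_def {p q : ClosedCond μ} : p ≤ q ↔ p.carrier = q.carrier ∩ Iic p.top := Iff.rfl

theorem mem_iff_of_le {p q : ClosedCond μ} (h : p ≤ q) {x : Ordinal.{u}} (hx : x ≤ p.top) :
    x ∈ p.carrier ↔ x ∈ q.carrier := by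
  rw [le_def.1 h]
  exact and_iff_left hx

theorem top_le_of_le {p q : ClosedCond μ} (h : p ≤ q) : p.top ≤ q.top :=
  q.le_top _ ((mem_iff_of_le h le_rfl).1 p.top_mem)

/-- Extend a condition by one point above its maximum. -/
def add (p : ClosedCond μ) (x : Ordinal.{u}) (hx : p.top < x) (hxμ : x < μ) : ClosedCond μ where
  carrier := insert x p.carrier
  top := x
  zero_mem := Or.inr p.zero_mem
  top_mem := Or.inl rfl
  le_top := by
    rintro y (rfl | hy)
    · exact le_rfl
    · exact (p.le_top y hy).trans hx.le
  top_lt := hxμ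
  closed y hy := by
    rw [mem_insert_iff, not_or] at hy
    rcases lt_or_gt_of_ne hy.1 with h | h
    · obtain ⟨w, hw, hwz⟩ := p.closed y hy.2
      refine ⟨w, hw, ?_⟩
      rintro z (rfl | hz) hzy
      · exact absurd h hzy.not_gt
      · exact hwz z hz hzy
    · refine ⟨x, h, ?_⟩
      rintro z (rfl | hz) hzy
      · exact le_rfl
      · exact (p.le_top z hz).trans hx.le

theorem le_add (p : ClosedCond μ) {x : Ordinal.{u}} (hx : p.top < x) (hxμ : x < μ) :
    p ≤ p.add x hx hxμ := by
  rw [le_def]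
  ext y
  constructor
  · exact fun hy => ⟨Or.inr hy, p.le_top y hy⟩
  · rintro ⟨rfl | hy, h⟩
    · exact absurd hx (not_lt.2 h)
    · exact hy

/-- The condition `{0}`. -/
def single (hμ : 0 < μ) : ClosedCond μ where
  carrier := {0}
  top := 0
  zero_mem := rfl
  top_mem := rfl
  le_top := by rintro x rfl; exact le_rfl
  top_lt := hμ
  closed x hx := ⟨0, pos_iff_ne_zero.2 hx, by rintro z rfl _; exact le_rfl⟩

/-- The bound is the union together with the supremum of the maxima, which stays below the regular
cardinal c⁺. -/
theorem exists_upperBound {c : Cardinal.{u}} (hc : ℵ₀ ≤ c)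
    (S : Set (ClosedCond (Order.succ c).ord)) (hS : IsChain (· ≤ ·) S)
    (hcard : #S ≤ Cardinal.lift.{u + 1} c) : ∃ b, ∀ s ∈ S, s ≤ b := by
  have hreg := Cardinal.isRegular_succ hc
  rcases S.eq_empty_or_nonempty with rfl | ⟨p₀, hp₀⟩
  · exact ⟨single hreg.ord_pos, fun s hs => absurd hs (notMem_empty s)⟩
  have hmem : ∀ p ∈ S, ∀ q ∈ S, ∀ x ∈ q.carrier, x ≤ p.top → x ∈ p.carrier := by
    intro p hp q hq x hx hxp
    rcases hS.total hp hq with h | h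
    · exact (mem_iff_of_le h hxp).2 hx
    · exact (mem_iff_of_le h (q.le_top x hx)).1 hx
  have hbdd : BddAbove (top '' S) :=
    ⟨(Order.succ c).ord, by rintro _ ⟨p, -, rfl⟩; exact p.top_lt.le⟩
  have hne : (top '' S).Nonempty := ⟨_, p₀, hp₀, rfl⟩
  let σ := sSup (top '' S)
  have hle : ∀ p ∈ S, p.top ≤ σ := fun p hp => le_csSup hbdd ⟨p, hp, rfl⟩
  have hσ : σ < (Order.succ c).ord := by
    refine Ordinal.sSup_lt_of_lt_cof ?_ (by rintro _ ⟨p, -, rfl⟩; exact p.top_lt)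
    rw [← Ordinal.lift_cof, hreg.cof_ord]
    exact (Cardinal.mk_image_le.trans hcard).trans_lt
      (Cardinal.lift_lt.2 (Order.lt_succ c))
  let A : Set Ordinal.{u} := insert σ (⋃ p ∈ S, p.carrier)
  have hA : ∀ p ∈ S, ∀ x ∈ A, x ≤ p.top → x ∈ p.carrier := by
    rintro p hp x (rfl | hx) hxp
    · exact (le_antisymm hxp (hle p hp)).symm ▸ p.top_mem
    · obtain ⟨q, hq, hxq⟩ := mem_iUnion₂.1 hx
      exact hmem p hp q hq x hxq hxp
  have hAσ : ∀ x ∈ A, x ≤ σ := by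
    rintro x (rfl | hx)
    · exact le_rfl
    · obtain ⟨q, hq, hxq⟩ := mem_iUnion₂.1 hx
      exact (q.le_top x hxq).trans (hle q hq)
  have hsub : ∀ p ∈ S, p.carrier ⊆ A := fun p hp x hx =>
    Or.inr (mem_iUnion₂.2 ⟨p, hp, hx⟩)
  refine ⟨⟨A, σ, hsub p₀ hp₀ p₀.zero_mem, Or.inl rfl, hAσ, hσ, fun x hx => ?_⟩, fun p hp => ?_⟩
  · rcases lt_trichotomy x σ with h | rfl | h
    · obtain ⟨_, ⟨p, hp, rfl⟩, hxp⟩ := exists_lt_of_lt_csSup hne h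
      obtain ⟨y, hy, hyz⟩ := p.closed x fun h' => hx (hsub p hp h')
      exact ⟨y, hy, fun z hz hzx => hyz z (hA p hp z hz (hzx.trans hxp).le) hzx⟩
    · exact absurd (Or.inl rfl) hx
    · exact ⟨σ, h, fun z hz _ => hAσ z hz⟩
  · exact Subset.antisymm (fun x hx => ⟨hsub p hp hx, p.le_top x hx⟩)
      fun x hx => hA p hp x hx.1 hx.2

/-- The point after the maximum is put in or left out against `A`; a further point above it fixes
that choice under end-extension. -/
theorem exists_extension (hμ : Order.IsSuccLimit μ) (p : ClosedCond μ) (A : Set Ordinal.{u}) :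
    ∃ q, p ≤ q ∧ p.top + 1 < q.top ∧ (p.top + 1 ∈ q.carrier ↔ p.top + 1 ∉ A) := by
  have h1 : p.top + 1 < μ := hμ.succ_lt p.top_lt
  have h2 : p.top + 1 + 1 < μ := hμ.succ_lt h1
  have l1 : p.top < p.top + 1 := Order.lt_succ _
  have l2 : p.top + 1 < p.top + 1 + 1 := Order.lt_succ _
  by_cases h : p.top + 1 ∈ A
  · refine ⟨p.add _ (l1.trans l2) h2, p.le_add _ _, l2, iff_of_false ?_ (not_not.2 h)⟩
    rintro (h' | h')
    · exact absurd h' l2.ne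
    · exact absurd (p.le_top _ h') l1.not_ge
  · exact ⟨(p.add _ l1 h1).add _ l2 h2, (p.le_add _ _).trans (le_add _ _ _), l2,
      iff_of_true (Or.inr (Or.inl rfl)) h⟩

end ClosedCond

/-! ### Functions representing κ and κ⁺ -/

theorem mk_Iio_lt_lift {δ : Cardinal.{u}} (x : Iio δ.ord) :
    #(Iio x) < Cardinal.lift.{u + 1} δ := by
  have h : #(Iio x) ≤ #(Iio (x : Ordinal.{u})) :=
    Cardinal.mk_le_of_injective (f := fun y : Iio x => (⟨y.1.1, y.2⟩ : Iio (x : Ordinal.{u})))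
      fun y z h => Subtype.ext (Subtype.ext (Subtype.mk.inj h))
  rw [Cardinal.mk_Iio_ordinal] at h
  exact h.trans_lt (Cardinal.lift_lt.2 (Cardinal.lt_ord.1 x.2))

namespace NormalUltrafilter

open Filter

variable {δ κ : Cardinal.{u}} (U : NormalUltrafilter δ)

theorem ae_gt (x : Iio δ.ord) : U.AE fun ξ => x < ξ := by
  have hc := U.complete
  have hcard := mk_Iio_lt_lift x
  have hne : ∀ y : Iio δ.ord, U.AE fun ξ => ξ ≠ y := fun y =>
    Ultrafilter.eventually_not.2 (U.nonprincipal y)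
  have hall : U.AE fun ξ => ∀ y (_ : y ∈ Iio x), ξ ≠ y :=
    (eventually_cardinal_ball hcard).2 fun y _ => hne y
  filter_upwards [hall, hne x] with ξ h1 h2
  exact lt_of_le_of_ne (not_lt.1 fun h => h1 ξ h rfl) h2.symm

theorem exists_ordOf_eq {f : Iio δ.ord → Ordinal.{u}} {ν : Ordinal.{u}} (h : ν < U.ordOf f)
    (hf : ∀ ξ, 0 < f ξ) : ∃ g : Iio δ.ord → Ordinal.{u}, U.ordOf g = ν ∧ ∀ ξ, g ξ < f ξ := by
  classical
  obtain ⟨g, rfl, hg⟩ := U.exists_of_lt_ordOf h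
  refine ⟨fun ξ => if g ξ < f ξ then g ξ else 0, U.ordOf_eq_iff.2 ?_, fun ξ => ?_⟩
  · filter_upwards [hg] with ξ hξ
    exact if_pos hξ
  · dsimp only
    split_ifs with h
    exacts [h, hf ξ]

theorem card_ordOf_const_le (ν : Ordinal.{u}) : (U.ordOf fun _ => ν).card ≤ ν.card ^ δ := by
  rcases eq_or_ne ν 0 with rfl | hν
  · have : U.ordOf (fun _ => (0 : Ordinal.{u})) = 0 := by
      by_contra h
      obtain ⟨g, -, hg⟩ := U.exists_of_lt_ordOf (pos_iff_ne_zero.2 h)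
      obtain ⟨ξ, hξ⟩ := hg.exists
      exact not_lt_zero hξ
    simp [this]
  choose g hg hlt using fun x : Iio (U.ordOf fun _ => ν) =>
    U.exists_ordOf_eq x.2 fun _ => pos_iff_ne_zero.2 hν
  have hle : #(Iio (U.ordOf fun _ => ν)) ≤ #(Iio δ.ord → Iio ν) := by
    refine Cardinal.mk_le_of_injective (f := fun x ξ => ⟨g x ξ, hlt x ξ⟩) fun x y h => ?_
    have : g x = g y := funext fun ξ => congrArg Subtype.val (congrFun h ξ)
    rw [Subtype.ext_iff, ← hg x, ← hg y, this]
  rw [← Cardinal.power_def, Cardinal.mk_Iio_ordinal, Cardinal.mk_Iio_ordinal,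
    Cardinal.mk_Iio_ordinal, Cardinal.card_ord, ← Cardinal.lift_power, Cardinal.lift_le] at hle
  exact hle

/-- `h ξ` is the supremum of the first `ξ` terms of a cofinal δ-sequence: fewer than cof κ of them,
and final segments of δ lie in U. -/
theorem exists_ae_le_of_cof_eq (hcof : κ.ord.cof = δ) :
    ∃ h : Iio δ.ord → Ordinal.{u}, (∀ ξ, h ξ < κ.ord) ∧ ∀ ν < κ.ord, U.AE fun ξ => ν ≤ h ξ := by
  obtain ⟨S, hS, hScard⟩ := Order.exists_cof_eq (Iio κ.ord)
  have hcard : #(Iio δ.ord) = #S := by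
    rw [hScard, Ordinal.cof_Iio, ← Ordinal.lift_cof, hcof, Cardinal.mk_Iio_ordinal,
      Cardinal.card_ord]
  obtain ⟨e⟩ := Cardinal.eq.1 hcard
  let c : Iio δ.ord → Ordinal.{u} := fun ξ => (e ξ).1.1
  have hc : ∀ ξ, c ξ < κ.ord := fun ξ => (e ξ).1.2
  refine ⟨fun ξ => sSup (c '' Iio ξ), fun ξ => ?_, fun ν hν => ?_⟩
  · refine Ordinal.sSup_lt_of_lt_cof ?_ (by rintro _ ⟨x, -, rfl⟩; exact hc x)
    rw [← Ordinal.lift_cof, hcof]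
    exact Cardinal.mk_image_le.trans_lt (mk_Iio_lt_lift ξ)
  · obtain ⟨s, hs, hνs⟩ := hS ⟨ν, hν⟩
    filter_upwards [U.ae_gt (e.symm ⟨s, hs⟩)] with ξ hξ
    have hcs : c (e.symm ⟨s, hs⟩) = s := by simp [c]
    refine le_trans (b := c (e.symm ⟨s, hs⟩)) (hcs ▸ hνs) (le_csSup ?_ ⟨_, hξ, rfl⟩)
    exact ⟨κ.ord, by rintro _ ⟨x, -, rfl⟩; exact (hc x).le⟩

theorem exists_ordOf_eq_ord (hκ : ℵ₀ < κ) (hcof : κ.ord.cof = δ)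
    (hlt : ∀ μ : Cardinal.{u}, μ < κ → μ ^ δ < κ) :
    ∃ k : Iio δ.ord → Ordinal.{u}, U.ordOf k = κ.ord ∧ (∀ ξ, ω ≤ k ξ) ∧ (∀ ξ, k ξ < κ.ord) ∧
      ∀ ν < κ.ord, U.AE fun ξ => ν < k ξ := by
  classical
  have hconst : ∀ ν < κ.ord, U.ordOf (fun _ => ν) < κ.ord := fun ν hν =>
    Cardinal.lt_ord.2 ((U.card_ordOf_const_le ν).trans_lt (hlt _ (Cardinal.lt_ord.1 hν)))
  have hω : ω < κ.ord := by rwa [← Cardinal.ord_aleph0, Cardinal.ord_lt_ord]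
  obtain ⟨h, hh, hle⟩ := U.exists_ae_le_of_cof_eq hcof
  have hκh : κ.ord ≤ U.ordOf h := by
    by_contra! hcon
    have h1 := U.ordOf_le_iff.2 (hle _ ((Cardinal.isSuccLimit_ord hκ.le).succ_lt hcon))
    exact absurd ((U.le_ordOf_const _).trans h1) (Order.lt_succ _).not_ge
  obtain ⟨k, hk, hkκ⟩ : ∃ k, U.ordOf k = κ.ord ∧ U.AE fun ξ => k ξ < κ.ord := by
    rcases hκh.eq_or_lt with heq | hlt
    · exact ⟨h, heq.symm, Eventually.of_forall hh⟩
    · obtain ⟨k, hk, hkh⟩ := U.exists_of_lt_ordOf hlt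
      exact ⟨k, hk, hkh.mono fun ξ h => h.trans (hh ξ)⟩
  have hkω : U.AE fun ξ => ω < k ξ := U.ordOf_lt_iff.1 (hk ▸ hconst _ hω)
  -- Changing `k` on a null set makes its bounds hold at every coordinate.
  let k' : Iio δ.ord → Ordinal.{u} := fun ξ => if ω ≤ k ξ ∧ k ξ < κ.ord then k ξ else ω
  have hk' : U.ordOf k' = κ.ord := by
    rw [← hk, ordOf_eq_iff]
    filter_upwards [hkκ, hkω] with ξ h1 h2
    exact if_pos ⟨h2.le, h1⟩
  refine ⟨k', hk', fun ξ => ?_, fun ξ => ?_, fun ν hν => U.ordOf_lt_iff.1 (hk' ▸ hconst ν hν)⟩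
  all_goals
    dsimp only [k']
    split_ifs with h
  exacts [h.1, le_rfl, h.2, hω]

theorem card_ordOf_le_of_card_le {f k : Iio δ.ord → Ordinal.{u}}
    (h : U.AE fun ξ => (f ξ).card ≤ (k ξ).card) : (U.ordOf f).card ≤ (U.ordOf k).card := by
  have hemb : ∀ ξ, ∃ e : Ordinal.{u} → Ordinal.{u}, (f ξ).card ≤ (k ξ).card →
      InjOn e (Iio (f ξ)) ∧ ∀ x < f ξ, e x < k ξ := fun ξ => by
    classical
    by_cases hξ : (f ξ).card ≤ (k ξ).card
    · have hle : #(Iio (f ξ)) ≤ #(Iio (k ξ)) := by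
        rwa [Cardinal.mk_Iio_ordinal, Cardinal.mk_Iio_ordinal, Cardinal.lift_le]
      obtain ⟨j⟩ := hle
      refine ⟨fun x => if hx : x < f ξ then (j ⟨x, hx⟩).1 else 0, fun _ =>
        ⟨fun x hx y hy hxy => ?_, fun x hx => ?_⟩⟩
      · dsimp only at hxy
        rw [dif_pos (mem_Iio.1 hx), dif_pos (mem_Iio.1 hy)] at hxy
        exact congrArg Subtype.val (j.injective (Subtype.ext hxy))
      · dsimp only
        rw [dif_pos hx]
        exact (j ⟨x, hx⟩).2
    · exact ⟨id, fun h => absurd h hξ⟩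
  choose e he using hemb
  choose g hg hlt using fun x : Iio (U.ordOf f) => U.exists_of_lt_ordOf x.2
  have hle : #(Iio (U.ordOf f)) ≤ #(Iio (U.ordOf k)) := by
    refine Cardinal.mk_le_of_injective
      (f := fun x => ⟨U.ordOf fun ξ => e ξ (g x ξ), U.ordOf_lt_iff.2 ?_⟩) fun x y hxy => ?_
    · filter_upwards [h, hlt x] with ξ h1 h2
      exact (he ξ h1).2 _ h2
    · have h' := U.ordOf_eq_iff.1 (congrArg Subtype.val hxy)
      rw [Subtype.ext_iff, ← hg x, ← hg y, ordOf_eq_iff]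
      filter_upwards [h, hlt x, hlt y, h'] with ξ h1 h2 h3 h4
      exact (he ξ h1).1 h2 h3 h4
  rwa [Cardinal.mk_Iio_ordinal, Cardinal.mk_Iio_ordinal, Cardinal.lift_le] at hle

/-- For ≤, pointwise injections into `k ξ` show that smaller ordinals have size at most κ. For ≥, a
represented ordinal of size at most κ would inject into κ by some `j`; the successor of the
supremum, at `ξ`, of the representatives with `j`-value below `k ξ` then represents an ordinal
distinct from all of them. -/
theorem ordOf_succ_eq {k : Iio δ.ord → Ordinal.{u}} (hk : U.ordOf k = κ.ord)
    (hω : ∀ ξ, ω ≤ k ξ) (hlt : ∀ ν < κ.ord, U.AE fun ξ => ν < k ξ) :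
    U.ordOf (fun ξ => (Order.succ (k ξ).card).ord) = (Order.succ κ).ord := by
  refine le_antisymm (le_of_forall_lt fun ν hν => ?_) ?_
  · obtain ⟨g, rfl, hg⟩ := U.exists_of_lt_ordOf hν
    rw [Cardinal.lt_ord, Order.lt_succ_iff, ← Cardinal.card_ord κ, ← hk]
    refine U.card_ordOf_le_of_card_le (hg.mono fun ξ hξ => ?_)
    rwa [Cardinal.lt_ord, Order.lt_succ_iff] at hξ
  · by_contra! hcon
    rw [Cardinal.lt_ord, Order.lt_succ_iff, ← Cardinal.card_ord κ, ← Cardinal.lift_le.{u + 1},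
      ← Cardinal.mk_Iio_ordinal, ← Cardinal.mk_Iio_ordinal] at hcon
    obtain ⟨j⟩ := hcon
    have hreg : ∀ ξ, (Order.succ (k ξ).card).IsRegular := fun ξ =>
      Cardinal.isRegular_succ (Ordinal.aleph0_le_card.2 (hω ξ))
    choose g hg hgμ using fun x : Iio (U.ordOf fun ξ => (Order.succ (k ξ).card).ord) =>
      U.exists_ordOf_eq x.2 fun ξ => (hreg ξ).ord_pos
    let S : Iio δ.ord → Set Ordinal.{u} := fun ξ => (fun x => g x ξ) '' {x | (j x).1 < k ξ}
    have hS : ∀ ξ, sSup (S ξ) < (Order.succ (k ξ).card).ord := fun ξ => by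
      refine Ordinal.sSup_lt_of_lt_cof ?_ (by rintro _ ⟨x, -, rfl⟩; exact hgμ x ξ)
      rw [← Ordinal.lift_cof, (hreg ξ).cof_ord]
      have h1 : #{x | (j x).1 < k ξ} ≤ #(Iio (k ξ)) :=
        Cardinal.mk_le_of_injective
          (f := fun x : {x | (j x).1 < k ξ} => (⟨(j x.1).1, x.2⟩ : Iio (k ξ)))
          fun x y h => Subtype.ext (j.injective (Subtype.ext (Subtype.mk.inj h)))
      rw [Cardinal.mk_Iio_ordinal] at h1
      exact (Cardinal.mk_image_le.trans h1).trans_lt (Cardinal.lift_lt.2 (Order.lt_succ _))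
    have hs : U.ordOf (fun ξ => Order.succ (sSup (S ξ))) <
        U.ordOf fun ξ => (Order.succ (k ξ).card).ord :=
      U.ordOf_lt_iff.2 (Eventually.of_forall fun ξ =>
        (Cardinal.isSuccLimit_ord (hreg ξ).aleph0_le).succ_lt (hS ξ))
    have h1 := U.ordOf_eq_iff.1 (hg ⟨_, hs⟩)
    obtain ⟨ξ, h2, h3⟩ := (h1.and (hlt _ (j ⟨_, hs⟩).2)).exists
    have h4 : g ⟨_, hs⟩ ξ ≤ sSup (S ξ) := le_csSup
      ⟨_, by rintro _ ⟨x, -, rfl⟩; exact (hgμ x ξ).le⟩ ⟨_, h3, rfl⟩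
    exact absurd (h2 ▸ h4) (Order.lt_succ _).not_ge

end NormalUltrafilter

/-- There are (2^κ)^δ = 2^κ = κ⁺ sequences to list. -/
theorem exists_enumeration {δ κ : Cardinal.{u}} (hκ : ℵ₀ ≤ κ) (hδ : δ ≤ κ) (hδ0 : δ ≠ 0)
    (hpow : (2 : Cardinal.{u}) ^ κ = Order.succ κ) :
    ∃ A : Ordinal.{u} → Iio δ.ord → Set Ordinal.{u}, ∀ a : Iio δ.ord → Set Ordinal.{u},
      ∃ γ < (Order.succ κ).ord, ∀ ξ, ∀ x < κ.ord, x ∈ A γ ξ ↔ x ∈ a ξ := by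
  classical
  have hcard : #(Iio δ.ord → Set (Iio κ.ord)) = #(Iio (Order.succ κ).ord) := by
    rw [← Cardinal.power_def, Cardinal.mk_set, Cardinal.mk_Iio_ordinal, Cardinal.mk_Iio_ordinal,
      Cardinal.mk_Iio_ordinal, Cardinal.card_ord, Cardinal.card_ord, Cardinal.card_ord,
      ← Cardinal.power_mul, ← Cardinal.lift_mul, Cardinal.mul_eq_left hκ hδ hδ0,
      ← Cardinal.lift_two_power, hpow]
  obtain ⟨e⟩ := Cardinal.eq.1 hcard
  refine ⟨fun γ ξ => if h : γ ∈ Iio (Order.succ κ).ord then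
    Subtype.val '' (e.symm ⟨γ, h⟩ ξ) else ∅, fun a => ?_⟩
  let b : Iio δ.ord → Set (Iio κ.ord) := fun ξ => {x | x.1 ∈ a ξ}
  refine ⟨(e b).1, (e b).2, fun ξ x hx => ?_⟩
  dsimp only
  rw [dif_pos (e b).2, Subtype.coe_eta, e.symm_apply_apply]
  constructor
  · rintro ⟨y, hy, rfl⟩
    exact hy
  · exact fun h => ⟨⟨x, hx⟩, h, rfl⟩

/-! ### The club generated by a chain -/

namespace NormalUltrafilter

open Filter

variable {δ : Cardinal.{u}} (U : NormalUltrafilter δ)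

instance : CountableInterFilter (U.toUltrafilter : Filter (Iio δ.ord)) :=
  have := U.complete
  CardinalInterFilter.toCountableInterFilter (c := Cardinal.lift.{u + 1} δ) _
    (by simpa using U.uncountable)

variable {Λ : Ordinal.{u}} {μ : Iio δ.ord → Ordinal.{u}}
  {F : Ordinal.{u} → ∀ ξ, ClosedCond (μ ξ)}

/-- The union of the closed sets represented in the ultrapower by the members of `F`. -/
def chainUnion (Λ : Ordinal.{u}) (F : Ordinal.{u} → ∀ ξ, ClosedCond (μ ξ)) : Set Ordinal.{u} :=
  {ν | ∃ γ < Λ, ν ∈ U.ordSetOf fun ξ => (F γ ξ).carrier}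

/-- Later conditions almost everywhere end-extend `F γ`, so they change nothing up to its top. -/
theorem mem_chainUnion_iff
    (hF : ∀ γ < Λ, ∀ β < γ, U.AE fun ξ => F β ξ ≤ F γ ξ) {γ ν : Ordinal.{u}} (hγ : γ < Λ)
    (hν : ν ≤ U.ordOf fun ξ => (F γ ξ).top) :
    ν ∈ U.chainUnion Λ F ↔ ν ∈ U.ordSetOf fun ξ => (F γ ξ).carrier := by
  refine ⟨?_, fun h => ⟨γ, hγ, h⟩⟩
  rintro ⟨γ', hγ', h⟩
  obtain ⟨g, rfl⟩ := U.ordOf_surjective ν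
  rw [ordOf_le_iff] at hν
  rw [ordOf_mem_ordSetOf_iff] at h ⊢
  rcases lt_trichotomy γ' γ with hlt | rfl | hlt
  · filter_upwards [h, hF γ hγ γ' hlt] with ξ h1 h2
    exact (ClosedCond.mem_iff_of_le h2 ((F γ' ξ).le_top _ h1)).1 h1
  · exact h
  · filter_upwards [h, hν, hF γ' hγ' γ hlt] with ξ h1 h2 h3
    exact (ClosedCond.mem_iff_of_le h3 h2).2 h1

theorem le_ordOf_top (hF : ∀ γ < Λ, ∀ β < γ, U.AE fun ξ => F β ξ ≤ F γ ξ)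
    (hs : ∀ γ, γ + 1 < Λ → ∀ ξ, (F γ ξ).top < (F (γ + 1) ξ).top) {γ : Ordinal.{u}} (hγ : γ < Λ) :
    γ ≤ U.ordOf fun ξ => (F γ ξ).top := by
  induction γ using WellFoundedLT.induction with
  | _ γ ih =>
    refine le_of_forall_lt fun β hβ => (ih β hβ (hβ.trans hγ)).trans_lt ?_
    have hβγ : β + 1 ≤ γ := Order.succ_le_of_lt hβ
    rw [ordOf_lt_iff]
    rcases hβγ.eq_or_lt with rfl | hlt
    · exact Eventually.of_forall (hs β hγ)
    · filter_upwards [hF γ hγ _ hlt] with ξ hξ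
      exact (hs β (hlt.trans hγ) ξ).trans_le (ClosedCond.top_le_of_le hξ)

theorem isClubIn_chainUnion (hμ : U.ordOf μ = Λ)
    (hF : ∀ γ < Λ, ∀ β < γ, U.AE fun ξ => F β ξ ≤ F γ ξ)
    (hle : ∀ γ < Λ, γ ≤ U.ordOf fun ξ => (F γ ξ).top) : IsClubIn (U.chainUnion Λ F) Λ := by
  refine ⟨?_, fun d hd _ _ a ha => ?_, fun a => ?_⟩
  · rintro ν ⟨γ, hγ, g, rfl, hg⟩
    rw [mem_Iio, ← hμ, ordOf_lt_iff]
    exact hg.mono fun ξ h => ((F γ ξ).le_top _ h).trans_lt (F γ ξ).top_lt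
  · by_contra hcon
    obtain ⟨ν, hν⟩ := a
    change ν ∉ U.chainUnion Λ F at hcon
    obtain ⟨g, hg⟩ := U.ordOf_surjective ν
    -- `F ν` already decides everything up to `ν`. The gaps below `g ξ` represent one gap of the
    -- union below `ν`, so `ν` is not the supremum of `d`.
    have hcon' : U.AE fun ξ => g ξ ∉ (F ν ξ).carrier :=
      Ultrafilter.eventually_not.2 fun h => hcon ⟨ν, hν, g, hg, h⟩
    have : ∀ ξ, ∃ y, g ξ ∉ (F ν ξ).carrier →
        y < g ξ ∧ ∀ z ∈ (F ν ξ).carrier, z < g ξ → z ≤ y := fun ξ => by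
      by_cases h : g ξ ∈ (F ν ξ).carrier
      · exact ⟨0, fun h' => absurd h h'⟩
      · obtain ⟨y, hy⟩ := (F ν ξ).closed _ h
        exact ⟨y, fun _ => hy⟩
    choose y hy using this
    have hyν : U.ordOf y < ν := by
      rw [← hg, ordOf_lt_iff]
      exact hcon'.mono fun ξ h => (hy ξ h).1
    have hub : (⟨U.ordOf y, hyν.trans hν⟩ : Iio Λ) ∈ upperBounds d := by
      intro b hb
      have hbD : b.1 ∈ U.chainUnion Λ F := hd hb
      have hbν : b.1 < ν := lt_of_le_of_ne (ha.1 hb) fun h => hcon (h ▸ hbD)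
      rw [U.mem_chainUnion_iff hF hν (hbν.le.trans (hle ν hν))] at hbD
      obtain ⟨z, hz, hzF⟩ := hbD
      rw [← hz, ← hg, ordOf_lt_iff] at hbν
      change b.1 ≤ U.ordOf y
      rw [← hz, ordOf_le_iff]
      filter_upwards [hcon', hbν, hzF] with ξ h1 h2 h3
      exact (hy ξ h1).2 _ h3 h2
    exact absurd (ha.2 hub) (not_le.2 hyν)
  · have hT : (U.ordOf fun ξ => (F a.1 ξ).top) < Λ :=
      (U.ordOf_lt_iff.2 (Eventually.of_forall fun ξ => (F a.1 ξ).top_lt)).trans_eq hμ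
    exact ⟨⟨_, hT⟩, ⟨a.1, a.2, _, rfl, Eventually.of_forall fun ξ => (F a.1 ξ).top_mem⟩,
      hle a.1 a.2⟩

theorem ordSetMem_chainUnion_inter_Iio
    (hF : ∀ γ < Λ, ∀ β < γ, U.AE fun ξ => F β ξ ≤ F γ ξ)
    (hle : ∀ γ < Λ, γ ≤ U.ordOf fun ξ => (F γ ξ).top) {α : Ordinal.{u}} (hα : α < Λ) :
    OrdSetMem (U.chainUnion Λ F ∩ Iio α) U.ult := by
  obtain ⟨g, hg⟩ := U.ordOf_surjective α
  have heq : U.chainUnion Λ F ∩ Iio α =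
      U.ordSetOf fun ξ => (F α ξ).carrier ∩ Iio (g ξ) := by
    ext ν
    obtain ⟨f, rfl⟩ := U.ordOf_surjective ν
    have hlt := U.ordOf_lt_iff (f := f) (g := g)
    rw [hg] at hlt
    refine (and_congr_left fun h =>
      U.mem_chainUnion_iff hF hα ((mem_Iio.1 h).le.trans (hle α hα))).trans ?_
    rw [ordOf_mem_ordSetOf_iff, ordOf_mem_ordSetOf_iff, mem_Iio, hlt]
    exact eventually_and.symm
  rw [heq]
  exact U.ordSetMem_ordSetOf _ fun ξ => ⟨_, fun x hx => (F α ξ).le_top x hx.1⟩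

theorem not_ordSetMem_chainUnion (hΛ : Order.IsSuccLimit Λ)
    (hF : ∀ γ < Λ, ∀ β < γ, U.AE fun ξ => F β ξ ≤ F γ ξ)
    {A : Ordinal.{u} → Iio δ.ord → Set Ordinal.{u}}
    (hA : ∀ a : Iio δ.ord → Set Ordinal.{u}, ∃ γ < Λ, ∀ ξ, ∀ x < μ ξ, x ∈ A γ ξ ↔ x ∈ a ξ)
    (hs : ∀ γ, γ + 1 < Λ → ∀ ξ, (F γ ξ).top + 1 < (F (γ + 1) ξ).top)
    (hd : ∀ γ, γ + 1 < Λ → ∀ ξ,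
      ((F γ ξ).top + 1 ∈ (F (γ + 1) ξ).carrier ↔ (F γ ξ).top + 1 ∉ A γ ξ)) :
    ¬ OrdSetMem (U.chainUnion Λ F) U.ult := by
  intro h
  obtain ⟨a, ha⟩ := U.exists_ordSetOf_of_ordSetMem h
  obtain ⟨γ, hγ, hγa⟩ := hA a
  have hγ' : γ + 1 < Λ := hΛ.succ_lt hγ
  -- At this ordinal step `γ + 1` decided membership against `a` at every coordinate.
  have h1 := U.mem_chainUnion_iff hF hγ' (ν := U.ordOf fun ξ => (F γ ξ).top + 1)
    (U.ordOf_le_iff.2 (Eventually.of_forall fun ξ => (hs γ hγ' ξ).le))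
  rw [ha, ordOf_mem_ordSetOf_iff, ordOf_mem_ordSetOf_iff] at h1
  have h2 : ∀ ξ, (F γ ξ).top + 1 ∈ (F (γ + 1) ξ).carrier ↔ (F γ ξ).top + 1 ∉ a ξ := fun ξ => by
    rw [hd γ hγ' ξ, hγa ξ _ ((hs γ hγ' ξ).trans (F (γ + 1) ξ).top_lt)]
  simp only [h2] at h1
  rw [AE, AE, Ultrafilter.eventually_not] at h1
  exact iff_not_self h1

end NormalUltrafilter

end FreshUlt

end

theorem mainTheorem7 (δ κ : Cardinal.{u}) (U : FreshUlt.NormalUltrafilter δ)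
    (hκ : κ.IsSingular) (hcof : κ.ord.cof = δ)
    (hpow : (2 : Cardinal.{u}) ^ κ = Order.succ κ)
    (hlt : ∀ μ : Cardinal.{u}, μ < κ → μ ^ δ < κ)
    (hsq : ∃ C : Ordinal.{u} → Set Ordinal.{u}, FreshUlt.IsSquareSeq κ C) :
    ∃ C : Set Ordinal.{u}, FreshUlt.IsClubIn C (Order.succ κ).ord ∧
      FreshUlt.IsFresh U.ult C := by
  obtain ⟨C, hC⟩ := hsq
  obtain ⟨L, t, hL⟩ := hC.exists_limitSystem
  have hδκ : δ < κ := hcof ▸ hκ.cof_ord_lt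
  have hκ0 : ℵ₀ < κ := U.uncountable.trans hδκ
  obtain ⟨k, hk, hω, hkκ, hkν⟩ := U.exists_ordOf_eq_ord hκ0 hcof hlt
  have hμ := U.ordOf_succ_eq hk hω hkν
  have hlim : ∀ ξ, Order.IsSuccLimit (Order.succ (k ξ).card).ord := fun ξ =>
    Cardinal.isSuccLimit_ord ((Ordinal.aleph0_le_card.2 (hω ξ)).trans (Order.le_succ _))
  -- Hence listing sequences of subsets of κ covers all subsets of each `|k ξ|⁺`.
  have hle : ∀ ξ, (Order.succ (k ξ).card).ord ≤ κ.ord := fun ξ =>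
    Cardinal.ord_le_ord.2 (Order.succ_le_of_lt (Cardinal.lt_ord.1 (hkκ ξ)))
  obtain ⟨A, hA⟩ := FreshUlt.exists_enumeration hκ0.le hδκ.le
    (pos_iff_ne_zero.1 (bot_le.trans_lt U.uncountable)) hpow
  choose E hE₁ hE₂ hE₃ using fun ξ => FreshUlt.ClosedCond.exists_extension (hlim ξ)
  obtain ⟨F, hF, hFs⟩ := hL.exists_chain hkν hω
    (fun ξ => FreshUlt.ClosedCond.exists_upperBound (Ordinal.aleph0_le_card.2 (hω ξ)))
    (fun γ p ξ => E ξ (p ξ) (A γ ξ)) (fun γ p ξ => hE₁ ξ (p ξ) (A γ ξ))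
  have hs : ∀ γ, γ + 1 < (Order.succ κ).ord → ∀ ξ, (F γ ξ).top + 1 < (F (γ + 1) ξ).top :=
    fun γ h ξ => by
      rw [hFs γ h]
      exact hE₂ ξ _ _
  have htop : ∀ γ < (Order.succ κ).ord, γ ≤ U.ordOf fun ξ => (F γ ξ).top := fun γ hγ =>
    U.le_ordOf_top hF (fun γ h ξ => (Order.lt_succ _).trans (hs γ h ξ)) hγ
  have hclub := U.isClubIn_chainUnion hμ hF htop
  have hub : (Order.succ κ).ord ∈ upperBounds (U.chainUnion (Order.succ κ).ord F) :=
    fun ν hν => (hclub.1 hν).le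
  refine ⟨_, hclub, ⟨_, hub⟩, ?_, fun α hα => ?_⟩
  · refine U.not_ordSetMem_chainUnion (A := A)
      (Cardinal.isSuccLimit_ord (hκ0.le.trans (Order.le_succ _))) hF (fun a => ?_) hs
      fun γ h ξ => ?_
    · obtain ⟨γ, hγ, h⟩ := hA a
      exact ⟨γ, hγ, fun ξ x hx => h ξ x (hx.trans_le (hle ξ))⟩
    · rw [hFs γ h]
      exact hE₃ ξ _ _
  · exact U.ordSetMem_chainUnion_inter_Iio hF htop (hα.trans_le (csSup_le' hub))
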